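/- Manifolds are understood in the sense of convenient calculus. A curve $c:\mathbb{R}\to E$ in a Hausdorff locally convex space is smooth if all its iterated derivatives exist; $E$ is convenient if every Mackey–Cauchy sequence in $E$ converges; a subset of $E$ is $c^\infty$-open if its preimage under every smooth curve is open; and a map from a $c^\infty$-open set to a locally convex space is smooth if it maps smooth curves to smooth curves. A $C^\infty$-manifold is a set $M$ with an atlas of charts, which are bijections from subsets covering $M$ onto $c^\infty$-open subsets of (possibly different, possibly infinite-dimensional) convenient vector spaces, such that the chart changes are smooth maps defined on $c^\infty$-open sets; no separation axiom is required. Finite-dimensional $C^\infty$-manifolds in the usual sense are a special case. The manifold $M$ is regarded as a diffeological space whose plots are the smooth parametrizations $U\to M$, with $U$ open in some $\mathbb{R}^n$. "$d<\dim M$" means that $d$ is smaller than the dimension of the model space of every chart with non-empty domain. For a diffeological space $X$ and an integer $d>0$, let $X_d$ be the set $X$ with the diffeology generated by the plots of $X$ of dimension $\le d$. For diffeological spaces $X,Y$, let $\mathcal{D}(X,Y)$ be the set of smooth maps with the functional diffeology ($p:U\to\mathcal{D}(X,Y)$ is a plot if and only if $(r,x)\mapsto p(r)(x)$ is smooth on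 $U\times X$). Let $\mathrm{Aut}_{\mathcal{D}}(X)$ be the group of diffeomorphisms of $X$ with the initial diffeology for the two maps $\varphi\mapsto\varphi$ and $\varphi\mapsto\varphi^{-1}$ to $\mathcal{D}(X,X)$. **Corollary 1.3.** Let $M$ be a $C^\infty$-manifold and let $d$ be an integer with $0<d<\dim M$. Then a bijection $f:M\to M$ belongs to $\mathrm{Aut}_{\mathcal{D}}(M_d)$ if and only if it is a diffeomorphism of the manifold $M$, so that $\mathrm{Aut}_{\mathcal{D}}(M_d)$ is, as a group under composition, the diffeomorphism group of $M$; and the diffeology of $\mathrm{Aut}_{\mathcal{D}}(M_d)$ is the discrete one, i.e. its plots are exactly the locally constant parametrizations. -/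

import Mathlib

open Set Filter Topology ContDiff

namespace SkeletalDiffeology

section ConvenientCalculus

/-- A curve in a real topological vector space is smooth if all its iterated derivatives exist,
i.e. there are `D 0 = c`, `D 1`, `D 2`, … such that `D (k + 1) t` is the limit of the difference
quotients of `D k` at `t`. -/
def IsSmoothCurve {E : Type*} [AddCommGroup E] [Module ℝ E] [TopologicalSpace E]
    (c : ℝ → E) : Prop :=
  ∃ D : ℕ → ℝ → E, D 0 = c ∧
    ∀ (k : ℕ) (t : ℝ), Tendsto (slope (D k) t) (𝓝[≠] t) (𝓝 (D (k + 1) t))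

/-- A set is `c^∞`-open if it is open for the final topology of the smooth curves. -/
def IsCInftyOpen {E : Type*} [AddCommGroup E] [Module ℝ E] [TopologicalSpace E]
    (s : Set E) : Prop :=
  ∀ c : ℝ → E, IsSmoothCurve c → IsOpen (c ⁻¹' s)

/-- Smoothness, in the sense of convenient calculus, of a map defined on a (`c^∞`-open) set `s`:
smooth curves in `s` are mapped to smooth curves. -/
def IsConvSmoothOn {E F : Type*} [AddCommGroup E] [Module ℝ E] [TopologicalSpace E]
    [AddCommGroup F] [Module ℝ F] [TopologicalSpace F] (f : E → F) (s : Set E) : Prop :=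
  ∀ c : ℝ → E, IsSmoothCurve c → (∀ t, c t ∈ s) → IsSmoothCurve (f ∘ c)

/-- Convenient vector spaces: Hausdorff locally convex spaces in which every Mackey-Cauchy
sequence converges. A sequence `x` is Mackey-Cauchy if `x m - x n ∈ r m n B` for some bounded
set `B` and some scalars `r m n` that tend to `0` as `m, n → ∞`. -/
class ConvenientSpace (E : Type*) [AddCommGroup E] [Module ℝ E] [TopologicalSpace E] : Prop
    extends IsTopologicalAddGroup E, ContinuousSMul ℝ E, LocallyConvexSpace ℝ E, T2Space E where
  mackey_complete : ∀ (x : ℕ → E) (B : Set E) (r : ℕ → ℕ → ℝ), Bornology.IsVonNBounded ℝ B →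
    Tendsto (fun q : ℕ × ℕ => r q.1 q.2) atTop (𝓝 0) →
    (∀ m n, ∃ b ∈ B, x m - x n = r m n • b) → ∃ y, Tendsto x atTop (𝓝 y)

/-- Two smooth curves that agree near `t` have derivatives that agree near `t`. -/
theorem eventuallyEq_of_slope {E : Type*} [AddCommGroup E] [Module ℝ E] [TopologicalSpace E]
    [T2Space E] {a b : ℕ → ℝ → E}
    (ha : ∀ (k : ℕ) (t : ℝ), Tendsto (slope (a k) t) (𝓝[≠] t) (𝓝 (a (k + 1) t)))
    (hb : ∀ (k : ℕ) (t : ℝ), Tendsto (slope (b k) t) (𝓝[≠] t) (𝓝 (b (k + 1) t)))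
    {t : ℝ} (h : a 0 =ᶠ[𝓝 t] b 0) (k : ℕ) : a k =ᶠ[𝓝 t] b k := by
  induction k with
  | zero => exact h
  | succ k ih =>
    filter_upwards [ih.eventuallyEq_nhds] with s hs
    refine tendsto_nhds_unique (ha k s) ((hb k s).congr' ?_)
    have h1 := hs.eq_of_nhds
    filter_upwards [hs.filter_mono nhdsWithin_le_nhds] with u hu
    simp [slope, hu, h1]

/-- Smoothness of curves is a local property. -/
theorem isSmoothCurve_of_local {E : Type*} [AddCommGroup E] [Module ℝ E] [TopologicalSpace E]
    [T2Space E] {c : ℝ → E} (h : ∀ t, ∃ e : ℝ → E, IsSmoothCurve e ∧ e =ᶠ[𝓝 t] c) :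
    IsSmoothCurve c := by
  choose e he hec using h
  choose D hD0 hD using he
  refine ⟨fun k t => D t k t, ?_, fun k t => ?_⟩
  · funext t
    simp only [hD0]
    exact (hec t).eq_of_nhds
  · refine (hD t k t).congr' ?_
    have key : ∀ᶠ s in 𝓝 t, D t k s = D s k s := by
      filter_upwards [(hec t).eventuallyEq_nhds] with s hs
      refine (eventuallyEq_of_slope (hD t) (hD s) ?_ k).eq_of_nhds
      rw [hD0, hD0]
      exact hs.trans (hec s).symm
    filter_upwards [key.filter_mono nhdsWithin_le_nhds] with s hs
    simp [slope, hs]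

theorem isSmoothCurve_const {E : Type*} [AddCommGroup E] [Module ℝ E] [TopologicalSpace E]
    (x : E) : IsSmoothCurve (fun _ : ℝ => x) := by
  refine ⟨fun k _ => if k = 0 then x else 0, by simp, fun k t => ?_⟩
  have : slope (fun _ : ℝ => if k = 0 then x else 0) t = fun _ => 0 := by
    funext s; simp [slope]
  rw [this]
  simpa using tendsto_const_nhds

/-- In a normed space the smooth curves are the usual ones. -/
theorem isSmoothCurve_iff_contDiff {E : Type*} [NormedAddCommGroup E] [NormedSpace ℝ E]
    {c : ℝ → E} : IsSmoothCurve c ↔ ContDiff ℝ ∞ c := by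
  constructor
  · rintro ⟨D, hD0, hD⟩
    have h1 : ∀ k t, HasDerivAt (D k) (D (k + 1) t) t :=
      fun k t => hasDerivAt_iff_tendsto_slope.2 (hD k t)
    have h2 : ∀ k, iteratedDeriv k c = D k := by
      intro k
      induction k with
      | zero => simp [hD0]
      | succ k ih =>
        rw [iteratedDeriv_succ, ih]
        funext t
        exact (h1 k t).deriv
    refine contDiff_of_differentiable_iteratedDeriv fun k _ => ?_
    rw [h2]
    exact fun t => (h1 k t).differentiableAt
  · intro h
    refine ⟨fun k => iteratedDeriv k c, by simp, fun k t => ?_⟩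
    rw [← hasDerivAt_iff_tendsto_slope]
    simp only [iteratedDeriv_succ]
    exact ((h.differentiable_iteratedDeriv k (by exact_mod_cast ENat.natCast_lt_top k)) t).hasDerivAt

/-- Smooth reparametrizations of the line that are the identity near `t` and have values in a
given neighbourhood of `t`. -/
theorem exists_localizer {t : ℝ} {N : Set ℝ} (hN : N ∈ 𝓝 t) :
    ∃ φ : ℝ → ℝ, ContDiff ℝ ∞ φ ∧ φ =ᶠ[𝓝 t] id ∧ ∀ s, φ s ∈ N := by
  obtain ⟨δ, hδ, hb⟩ := Metric.mem_nhds_iff.1 hN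
  let ψ : ContDiffBump t := ⟨δ / 4, δ / 2, by positivity, by linarith⟩
  refine ⟨fun s => t + ψ s * (s - t), ?_, ?_, fun s => hb ?_⟩
  · exact contDiff_const.add (ψ.contDiff.mul (contDiff_id.sub contDiff_const))
  · filter_upwards [ψ.eventuallyEq_one] with s hs
    simp [hs]
  · rw [Metric.mem_ball, Real.dist_eq]
    have h0 : 0 ≤ ψ s := ψ.nonneg
    have h1 : ψ s ≤ 1 := ψ.le_one
    rw [add_sub_cancel_left, abs_mul, abs_of_nonneg h0]
    by_cases h : |s - t| < δ
    · calc ψ s * |s - t| ≤ 1 * |s - t| := by gcongr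
        _ < δ := by linarith
    · have : ψ s = 0 := ψ.zero_of_le_dist (by
        change δ / 2 ≤ dist s t
        rw [Real.dist_eq]; linarith)
      rw [this]; simpa using hδ

end ConvenientCalculus

section Manifolds

/-- A smooth atlas on the set `M`: the charts are bijections from subsets that cover `M` onto
`c^∞`-open subsets of the vector spaces `E i`, and the changes of charts are defined on
`c^∞`-open sets and smooth. A set with such an atlas, where the `E i` are convenient vector
spaces, is a `C^∞`-manifold in the sense of convenient calculus. -/
structure SmoothAtlas {ι : Type*} (E : ι → Type*) [∀ i, AddCommGroup (E i)]
    [∀ i, Module ℝ (E i)] [∀ i, TopologicalSpace (E i)] (M : Type*) where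
  /-- The charts. -/
  chart : ∀ i, PartialEquiv M (E i)
  cover : ∀ x, ∃ i, x ∈ (chart i).source
  isCInftyOpen_target : ∀ i, IsCInftyOpen (chart i).target
  isCInftyOpen_change : ∀ i j, IsCInftyOpen ((chart i).symm.trans (chart j)).source
  smooth_change : ∀ i j, IsConvSmoothOn ((chart i).symm.trans (chart j))
    ((chart i).symm.trans (chart j)).source

/-- The atlas of a vector space that consists of the identity. -/
def selfAtlas (V : Type*) [AddCommGroup V] [Module ℝ V] [TopologicalSpace V] :
    SmoothAtlas (fun _ : Unit => V) V where
  chart _ := PartialEquiv.refl V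
  cover _ := ⟨(), mem_univ _⟩
  isCInftyOpen_target _ _ _ := by simp
  isCInftyOpen_change _ _ _ _ := by simp
  smooth_change _ _ _ hc _ := hc

variable {ι κ : Type*} {E : ι → Type*} [∀ i, AddCommGroup (E i)]
  [∀ i, Module ℝ (E i)] [∀ i, TopologicalSpace (E i)] {F : κ → Type*} [∀ j, AddCommGroup (F j)]
  [∀ j, Module ℝ (F j)] [∀ j, TopologicalSpace (F j)] {M N : Type*}

/-- The domain, in the chart `i` of `M`, of the expression of `f : u → N` in the charts `i` and
`j`. -/
def localDomain (A : SmoothAtlas E M) (B : SmoothAtlas F N) (f : M → N) (u : Set M)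
    (i : ι) (j : κ) : Set (E i) :=
  {y | y ∈ (A.chart i).target ∧ (A.chart i).symm y ∈ u ∧
    f ((A.chart i).symm y) ∈ (B.chart j).source}

/-- The restriction of `f` to the open set `u` is a smooth map of manifolds: its expression in any
two charts is defined on a `c^∞`-open set and smooth. -/
def IsSmoothMapOn (A : SmoothAtlas E M) (B : SmoothAtlas F N) (f : M → N) (u : Set M) : Prop :=
  ∀ i j, IsCInftyOpen (localDomain A B f u i j) ∧
    IsConvSmoothOn (B.chart j ∘ f ∘ (A.chart i).symm) (localDomain A B f u i j)

/-- Smooth maps of manifolds. -/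
def IsSmoothMap (A : SmoothAtlas E M) (B : SmoothAtlas F N) (f : M → N) : Prop :=
  IsSmoothMapOn A B f univ

/-- A parametrization is smooth if and only if its composites with smooth curves are smooth in
the charts. -/
theorem isSmoothMapOn_selfAtlas {V : Type*} [AddCommGroup V] [Module ℝ V] [TopologicalSpace V]
    {B : SmoothAtlas F N} {p : V → N} {u : Set V} :
    IsSmoothMapOn (selfAtlas V) B p u ↔
      ∀ j, IsCInftyOpen (u ∩ p ⁻¹' (B.chart j).source) ∧
        IsConvSmoothOn (B.chart j ∘ p) (u ∩ p ⁻¹' (B.chart j).source) := by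
  have h : ∀ i j, localDomain (selfAtlas V) B p u i j = u ∩ p ⁻¹' (B.chart j).source := by
    intro i j
    ext y
    simp [localDomain, selfAtlas]
  constructor
  · intro H j
    have := H () j
    rw [h] at this
    exact this
  · intro H i j
    rw [h]
    exact H j

theorem isSmoothMapOn_congr {A : SmoothAtlas E M} {B : SmoothAtlas F N} {f g : M → N}
    {u : Set M} (h : EqOn f g u) (hf : IsSmoothMapOn A B f u) : IsSmoothMapOn A B g u := by
  intro i j
  have e : localDomain A B g u i j = localDomain A B f u i j := by
    ext y
    simp only [localDomain, mem_ofPred_eq]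
    refine and_congr_right fun _ => and_congr_right fun hy => ?_
    rw [h hy]
  rw [e]
  refine ⟨(hf i j).1, fun c hc hcu => ?_⟩
  have : (B.chart j ∘ g ∘ (A.chart i).symm) ∘ c = (B.chart j ∘ f ∘ (A.chart i).symm) ∘ c := by
    funext t
    simp only [Function.comp_apply]
    rw [h (hcu t).2.1]
  rw [this]
  exact (hf i j).2 c hc hcu

theorem isSmoothMapOn_reparam [∀ j, T2Space (F j)] {B : SmoothAtlas F N} {n m : ℕ}
    {u : Set (EuclideanSpace ℝ (Fin n))} {v : Set (EuclideanSpace ℝ (Fin m))} (hv : IsOpen v)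
    {p : EuclideanSpace ℝ (Fin n) → N}
    {f : EuclideanSpace ℝ (Fin m) → EuclideanSpace ℝ (Fin n)} (hfv : MapsTo f v u)
    (hp : IsSmoothMapOn (selfAtlas (EuclideanSpace ℝ (Fin n))) B p u)
    (hf : ContDiffOn ℝ ∞ f v) :
    IsSmoothMapOn (selfAtlas (EuclideanSpace ℝ (Fin m))) B (p ∘ f) v := by
  rw [isSmoothMapOn_selfAtlas] at hp ⊢
  have key : ∀ (c : ℝ → EuclideanSpace ℝ (Fin m)) (N : Set ℝ) (t : ℝ), IsSmoothCurve c →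
      N ∈ 𝓝 t → (∀ s ∈ N, c s ∈ v) → ∃ φ : ℝ → ℝ, φ =ᶠ[𝓝 t] id ∧ (∀ s, φ s ∈ N) ∧
        IsSmoothCurve (fun s => f (c (φ s))) := by
    intro c N t hc hN hcv
    obtain ⟨φ, hφ, hφt, hφN⟩ := exists_localizer hN
    refine ⟨φ, hφt, hφN, isSmoothCurve_iff_contDiff.2 ?_⟩
    exact hf.comp_contDiff ((isSmoothCurve_iff_contDiff.1 hc).comp hφ) fun s => hcv _ (hφN s)
  intro j
  constructor
  · intro c hc
    rw [isOpen_iff_mem_nhds]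
    intro t ht
    have hcc : Continuous c := (isSmoothCurve_iff_contDiff.1 hc).continuous
    have hN : c ⁻¹' v ∈ 𝓝 t := (hv.preimage hcc).mem_nhds ht.1
    obtain ⟨φ, hφt, -, hs⟩ := key c _ t hc hN fun s hs => hs
    have ho := (hp j).1 _ hs
    have hφt' : φ t = t := hφt.eq_of_nhds
    have hm : t ∈ (fun s => f (c (φ s))) ⁻¹' (u ∩ p ⁻¹' (B.chart j).source) := by
      simp only [mem_preimage, hφt', mem_inter_iff]
      exact ⟨hfv ht.1, ht.2⟩
    filter_upwards [ho.mem_nhds hm, hφt, hN] with s h1 h2 h3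
    refine ⟨h3, ?_⟩
    have h4 := h1.2
    simp only [mem_preimage, h2, id] at h4
    exact h4
  · intro c hc hcv
    refine isSmoothCurve_of_local fun t => ?_
    obtain ⟨φ, hφt, -, hs⟩ := key c univ t hc univ_mem fun s _ => (hcv s).1
    refine ⟨_, (hp j).2 _ hs fun s => ⟨hfv (hcv _).1, (hcv (φ s)).2⟩, ?_⟩
    filter_upwards [hφt] with s h
    simp [h]

theorem isSmoothMapOn_local [∀ j, T2Space (F j)] {B : SmoothAtlas F N} {n : ℕ}
    {u : Set (EuclideanSpace ℝ (Fin n))} {p : EuclideanSpace ℝ (Fin n) → N}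
    (hu : IsOpen u)
    (h : ∀ x ∈ u, ∃ (v : Set _) (_ : IsOpen v), x ∈ v ∧
      IsSmoothMapOn (selfAtlas (EuclideanSpace ℝ (Fin n))) B p v) :
    IsSmoothMapOn (selfAtlas (EuclideanSpace ℝ (Fin n))) B p u := by
  simp only [isSmoothMapOn_selfAtlas] at h ⊢
  intro j
  constructor
  · intro c hc
    rw [isOpen_iff_mem_nhds]
    intro t ht
    obtain ⟨v, hv, hxv, H⟩ := h (c t) ht.1
    have hcc : Continuous c := (isSmoothCurve_iff_contDiff.1 hc).continuous
    filter_upwards [((H j).1 c hc).mem_nhds (show t ∈ c ⁻¹' _ from ⟨hxv, ht.2⟩),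
      (hu.preimage hcc).mem_nhds ht.1] with s h1 h2
    exact ⟨h2, h1.2⟩
  · intro c hc hcu
    refine isSmoothCurve_of_local fun t => ?_
    obtain ⟨v, hv, hxv, H⟩ := h (c t) (hcu t).1
    have hcc : Continuous c := (isSmoothCurve_iff_contDiff.1 hc).continuous
    obtain ⟨φ, hφ, hφt, hφN⟩ := exists_localizer ((hv.preimage hcc).mem_nhds hxv)
    refine ⟨_, (H j).2 (c ∘ φ) (isSmoothCurve_iff_contDiff.2
      ((isSmoothCurve_iff_contDiff.1 hc).comp hφ)) fun s => ⟨hφN s, (hcu _).2⟩, ?_⟩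
    filter_upwards [hφt] with s h
    simp [h]

theorem isSmoothMapOn_const {B : SmoothAtlas F N} {n : ℕ} (x : N) :
    IsSmoothMapOn (selfAtlas (EuclideanSpace ℝ (Fin n))) B (fun _ => x) univ := by
  rw [isSmoothMapOn_selfAtlas]
  intro j
  refine ⟨fun c _ => ?_, fun c _ _ => isSmoothCurve_const _⟩
  by_cases h : x ∈ (B.chart j).source <;> simp [h]

/-- The diffeology of a manifold: its plots are the smooth parametrizations. -/
@[reducible]
def manifoldDiffeology [∀ j, T2Space (F j)] (B : SmoothAtlas F N) : DiffeologicalSpace N :=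
  .ofCorePlotsOn {
    isPlotOn := fun {n u} _ p => IsSmoothMapOn (selfAtlas (EuclideanSpace ℝ (Fin n))) B p u
    isPlotOn_congr := fun _ _ _ h => ⟨isSmoothMapOn_congr h, isSmoothMapOn_congr h.symm⟩
    isPlot_const := fun x => isSmoothMapOn_const x
    isPlotOn_reparam := fun hv _ _ h hp hf => isSmoothMapOn_reparam hv h hp hf
    locality := fun hu _ h => isSmoothMapOn_local hu h }

/-- Diffeomorphisms of a manifold `M`, as permutations of `M`. -/
def IsManifoldDiffeo (A : SmoothAtlas E M) (f : Equiv.Perm M) : Prop :=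
  IsSmoothMap A A f ∧ IsSmoothMap A A f.symm

end Manifolds

section Diffeologies

open Diffeology

variable {X Y : Type*}

/-- The `d`-skeletal diffeology: the diffeology generated by the plots of dimension at most
`d`. -/
@[reducible]
def skeletal (d : ℕ) (D : DiffeologicalSpace X) : DiffeologicalSpace X :=
  .generateFrom {p | p ∈ D.toPlots ∧ p.1 ≤ d}

/-- The initial diffeology for a map `f : X → Y`. -/
@[reducible]
def initial (f : X → Y) (D : DiffeologicalSpace Y) : DiffeologicalSpace X where
  plots n := {p | f ∘ p ∈ D.plots n}
  constant_plots x := D.constant_plots (f x)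
  plot_reparam hp hf := D.plot_reparam hp hf
  locality h := D.locality h

/-- The product diffeology: the initial diffeology for the two projections. -/
@[reducible]
def prodDiffeology (D : DiffeologicalSpace X) (D' : DiffeologicalSpace Y) :
    DiffeologicalSpace (X × Y) :=
  initial Prod.fst D ⊓ initial Prod.snd D'

/-- The set of smooth maps between two diffeological spaces. -/
def SmoothMaps (D : DiffeologicalSpace X) (D' : DiffeologicalSpace Y) : Type _ :=
  {f : X → Y // @DSmooth X Y D D' f}

/-- The functional diffeology on the set of smooth maps: `p` is a plot if and only if
`(r, x) ↦ p r x` is smooth on the product. -/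
@[reducible]
def functional (D : DiffeologicalSpace X) (D' : DiffeologicalSpace Y) :
    DiffeologicalSpace (SmoothMaps D D') where
  plots n := {p | @DSmooth (EuclideanSpace ℝ (Fin n) × X) Y
    (prodDiffeology inferInstance D) D' (fun z => (p z.1).1 z.2)}
  constant_plots f n w hw := f.2 n _ (DiffeologicalSpace.isPlot_inf_iff.1 hw).2
  plot_reparam {n m p f} hp hf k w hw := by
    obtain ⟨h1, h2⟩ := DiffeologicalSpace.isPlot_inf_iff.1 hw
    refine hp k (fun z => (f (w z).1, (w z).2)) (DiffeologicalSpace.isPlot_inf_iff.2 ⟨?_, h2⟩)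
    exact hf.dSmooth k _ h1
  locality {n p} h k w hw := by
    obtain ⟨h1, h2⟩ := DiffeologicalSpace.isPlot_inf_iff.1 hw
    have h1' : ContDiff ℝ ∞ (fun z => (w z).1) := IsPlot.contDiff h1
    refine D'.locality fun z => ?_
    obtain ⟨u, hu, hzu, H⟩ := h (w z).1
    refine ⟨_, hu.preimage h1'.continuous, hzu, fun {m g} hg hgs => ?_⟩
    refine H (f := fun y => (w (g y)).1) hg (h1'.comp hgs) m (fun y => (y, (w (g y)).2))
      (DiffeologicalSpace.isPlot_inf_iff.2 ⟨?_, ?_⟩)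
    · exact isPlot_id
    · exact D.plot_reparam h2 hgs

/-- The group of diffeomorphisms of a diffeological space, as a group of permutations. -/
def aut (D : DiffeologicalSpace X) : Subgroup (Equiv.Perm X) where
  carrier := {f | @DSmooth X X D D f ∧ @DSmooth X X D D f.symm}
  mul_mem' hf hg := ⟨fun n p hp => hf.1 n _ (hg.1 n p hp), fun n p hp => hg.2 n _ (hf.2 n p hp)⟩
  one_mem' := ⟨fun _ _ hp => hp, fun _ _ hp => hp⟩
  inv_mem' hf := ⟨hf.2, hf.1⟩

/-- The map `φ ↦ φ` from the automorphism group to the smooth maps. -/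
def autIncl (D : DiffeologicalSpace X) (φ : aut D) : SmoothMaps D D :=
  ⟨φ.1, φ.2.1⟩

/-- The map `φ ↦ φ⁻¹` from the automorphism group to the smooth maps. -/
def autInv (D : DiffeologicalSpace X) (φ : aut D) : SmoothMaps D D :=
  ⟨φ.1.symm, φ.2.2⟩

/-- The diffeology of the automorphism group: the initial diffeology for `φ ↦ φ` and
`φ ↦ φ⁻¹`. -/
@[reducible]
def autDiffeology (D : DiffeologicalSpace X) : DiffeologicalSpace (aut D) :=
  initial (autIncl D) (functional D D) ⊓ initial (autInv D) (functional D D)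

/-- The discrete diffeology: the plots are the locally constant parametrizations. -/
@[reducible]
def discrete (X : Type*) : DiffeologicalSpace X :=
  .ofCorePlotsOn {
    isPlotOn := fun {_ u} _ p => ∀ x ∈ u, ∀ᶠ y in 𝓝 x, p y = p x
    isPlotOn_congr := fun {n u} hu p q h => by
      refine forall₂_congr fun x hx => eventually_congr ?_
      filter_upwards [hu.mem_nhds hx] with y hy
      rw [h hx, h hy]
    isPlot_const := fun x _ _ => Eventually.of_forall fun _ => rfl
    isPlotOn_reparam := fun hv p f h hp hf x hx =>
      ((hf.continuousOn.continuousAt (hv.mem_nhds hx)).eventually (hp _ (h hx)))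
    locality := fun _ _ h x hx => by
      obtain ⟨v, hv, hxv, H⟩ := h x hx
      exact H x hxv }

end Diffeologies

end SkeletalDiffeology

/-! Automorphisms. Smoothness of maps between manifolds is tested on smooth curves, and for `d > 0`
the manifold and its skeletal diffeology have the same one-dimensional plots; so automorphisms are
diffeomorphisms. Conversely a diffeomorphism permutes the generating plots (`mem_aut_skeletal_iff`).

Discreteness. A plot of the skeletal diffeology factors locally through plots of dimension at most
`d` (`exists_factor_of_isPlot_skeletal`), so it has "rank at most `d`". Let `p` be a smooth family
of automorphisms and suppose that an orbit `s ↦ p (r s) x` has velocity `v` in a chart at time `t`.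
As `d` is less than the dimension, there is a `d`-dimensional affine plane through `p (r t) x`,
transverse to `v`. Pulled back by `p (r t)`, it becomes a `d`-dimensional plot `w` of the skeletal
diffeology, and `(a, u) ↦ p (r (t + a)) (w u)` is a plot of dimension `d + 1`. Its derivative
contains the plane and `v`, which exceeds the rank bound unless `v = 0` (`not_factor_of_transverse`,
`eq_zero_of_tendsto_slope_orbit`). All orbits are therefore stationary and the family is constant.

The rank argument needs Fréchet derivatives, while plots are only known to be smooth along curves.
Composed with continuous functionals, they become differentiable by the first order case of Boman's
theorem (`differentiable_of_curvewise`); by Hahn–Banach the functionals lose no information. -/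

namespace SkeletalDiffeology

/-! ### Functions that are smooth along all smooth curves -/

section CurvewiseSmoothFunctions

variable {V : Type*} [NormedAddCommGroup V] [NormedSpace ℝ V]

theorem norm_iteratedFDeriv_comp_affine_smul_le {θ : ℝ → ℝ} (hθ : ContDiff ℝ ∞ θ) (y : V) (k : ℕ)
    {K : ℝ} (hK : ∀ t, ‖iteratedFDeriv ℝ k θ t‖ ≤ K) (a b t : ℝ) :
    ‖iteratedFDeriv ℝ k (fun t => θ (a * t - b) • y) t‖ ≤ ‖y‖ * (|a| ^ k * K) := by
  have hs : ContDiff ℝ ∞ fun t => θ (t - b) := hθ.comp (contDiff_id.sub contDiff_const)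
  have hf : ContDiff ℝ ∞ fun t => θ (a * t - b) :=
    hs.comp (contDiff_const.mul contDiff_id)
  have h1 := ((ContinuousLinearMap.id ℝ ℝ).smulRight y).norm_iteratedFDeriv_comp_left
    (f := fun t => θ (a * t - b)) (x := t) hf.contDiffAt (n := k)
    (by exact_mod_cast le_top)
  refine h1.trans ?_
  have h5 : ‖ContinuousLinearMap.id ℝ ℝ‖ = 1 := ContinuousLinearMap.norm_id
  have h2 := congrFun (iteratedDeriv_comp_const_mul (n := k) (f := fun t => θ (t - b))
    (hs.of_le (by exact_mod_cast le_top)) a) t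
  rw [norm_iteratedFDeriv_eq_norm_iteratedDeriv, ContinuousLinearMap.norm_smulRight_apply, h2,
    iteratedDeriv_comp_sub_const, norm_mul, norm_pow, h5, one_mul, Real.norm_eq_abs,
    ← norm_iteratedFDeriv_eq_norm_iteratedDeriv]
  gcongr
  exact hK _

/-- The `k`-th derivative of the `n`-th term grows at most like `(2 ^ k) ^ n / n!`. Factorial decay
beats this geometric growth for every `k` at once, so all derived series converge uniformly. -/
theorem contDiff_tsum_dyadic_smul [CompleteSpace V] {θ : ℝ → ℝ} (hθ : ContDiff ℝ ∞ θ)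
    (hc : HasCompactSupport θ) {y : ℕ → V} {C : ℝ} (hy : ∀ n, ‖y n‖ ≤ C / n.factorial) :
    ContDiff ℝ ∞ fun t => ∑' n, θ (8 * 2 ^ n * t - 8) • y n := by
  have hC : ∀ k : ℕ, ∃ K, 0 ≤ K ∧ ∀ t, ‖iteratedFDeriv ℝ k θ t‖ ≤ K := fun k => by
    have h1 : Continuous (iteratedFDeriv ℝ k θ) :=
      hθ.continuous_iteratedFDeriv (by exact_mod_cast le_top)
    obtain ⟨K, hK⟩ := h1.bounded_above_of_compact_support (hc.iteratedFDeriv k)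
    exact ⟨K, (norm_nonneg _).trans (hK 0), hK⟩
  choose K hK0 hK using hC
  have hsum : ∀ k : ℕ, (k : ℕ∞) ≤ ⊤ → Summable fun n : ℕ =>
      K k * 8 ^ k * C * (((2 : ℝ) ^ k) ^ n / n.factorial) :=
    fun k _ => (Real.summable_pow_div_factorial _).mul_left _
  refine contDiff_tsum (fun n => ?_) hsum fun k n t _ => ?_
  · exact (hθ.comp ((contDiff_const.mul contDiff_id).sub contDiff_const)).smul contDiff_const
  · refine (norm_iteratedFDeriv_comp_affine_smul_le hθ (y n) k (hK k) _ _ t).trans ?_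
    have h3 : |(8 * 2 ^ n : ℝ)| = 8 * 2 ^ n := abs_of_nonneg (by positivity)
    rw [h3]
    calc ‖y n‖ * ((8 * 2 ^ n) ^ k * K k)
        ≤ (C / n.factorial) * ((8 * 2 ^ n) ^ k * K k) :=
          mul_le_mul_of_nonneg_right (hy n) (mul_nonneg (by positivity) (hK0 k))
      _ = K k * 8 ^ k * C * ((2 ^ k) ^ n / n.factorial) := by
          rw [mul_pow, ← pow_mul, ← pow_mul, mul_comm n k]; ring

/-- The `n`-th term vanishes unless `2 ^ n * t` lies between `7 / 8` and `9 / 8`, and these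
intervals of `t` are disjoint for distinct `n`. -/
theorem tsum_dyadic_smul_eventuallyEq {θ : ℝ → ℝ} (h0 : ∀ t, 1 ≤ |t| → θ t = 0) (y : ℕ → V)
    (n : ℕ) :
    (fun t => ∑' m, θ (8 * 2 ^ m * t - 8) • y m) =ᶠ[𝓝 (1 / 2 ^ n)]
      fun t => θ (8 * 2 ^ n * t - 8) • y n := by
  have hp : (0 : ℝ) < 2 ^ n := by positivity
  have h1 : Tendsto (fun t : ℝ => 2 ^ n * t) (𝓝 (1 / 2 ^ n)) (𝓝 1) := by
    have : ContinuousAt (fun t : ℝ => 2 ^ n * t) (1 / 2 ^ n) := by fun_prop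
    convert this.tendsto using 2
    field_simp
  filter_upwards [h1.eventually (Ioo_mem_nhds (show (7 / 8 : ℝ) < 1 by norm_num)
    (show (1 : ℝ) < 9 / 8 by norm_num))] with t ht
  obtain ⟨ha, hb⟩ := ht
  have ht0 : 0 < t := by
    by_contra! h
    nlinarith
  refine tsum_eq_single n fun m hm => ?_
  rw [h0, zero_smul]
  rw [le_abs]
  rcases lt_or_gt_of_ne hm with h | h
  · right
    have : (2 : ℝ) ^ (m + 1) ≤ 2 ^ n := pow_le_pow_right₀ (by norm_num) h
    rw [pow_succ] at this
    nlinarith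
  · left
    have : (2 : ℝ) ^ (n + 1) ≤ 2 ^ m := pow_le_pow_right₀ (by norm_num) h
    rw [pow_succ] at this
    nlinarith

/-- The special curve lemma: a fast converging sequence, together with short segments through its
members, lies on a smooth curve. -/
theorem exists_contDiff_curve_through [CompleteSpace V] {x : V} (v : V) {y : ℕ → V}
    (hy : ∀ n, ‖y n - x‖ ≤ 1 / n.factorial) :
    ∃ c : ℝ → V, ContDiff ℝ ∞ c ∧ c 0 = x ∧
      ∀ n : ℕ, c =ᶠ[𝓝 (1 / 2 ^ n)]
        fun t => y n + ((1 / n.factorial : ℝ) * (t - 1 / 2 ^ n)) • v := by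
  let φ : ContDiffBump (0 : ℝ) := ⟨1 / 2, 1, by norm_num, by norm_num⟩
  have hφ0 : ∀ t : ℝ, 1 ≤ |t| → φ t = 0 := fun t ht => φ.zero_of_le_dist (by simpa using ht)
  have hψ0 : ∀ t : ℝ, 1 ≤ |t| → t * φ t = 0 := fun t ht => by rw [hφ0 t ht, mul_zero]
  -- Since `8 * 2 ^ n * t - 8 = 8 * 2 ^ n * (t - 1 / 2 ^ n)`, this coefficient gives the segment
  -- velocity `v / n!`.
  let z : ℕ → V := fun n => (1 / n.factorial / (8 * 2 ^ n) : ℝ) • v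
  have hz : ∀ n, ‖z n‖ ≤ ‖v‖ / n.factorial := fun n => by
    have h1 : (1 : ℝ) ≤ 8 * 2 ^ n := by
      have : (1 : ℝ) ≤ 2 ^ n := one_le_pow₀ (by norm_num)
      linarith
    have h2 : (0 : ℝ) < n.factorial := by positivity
    simp only [z]
    rw [norm_smul, Real.norm_of_nonneg (by positivity)]
    calc (1 / n.factorial / (8 * 2 ^ n) : ℝ) * ‖v‖ ≤ (1 / n.factorial / 1) * ‖v‖ := by gcongr
      _ = ‖v‖ / n.factorial := by ring
  refine ⟨fun t => x + ∑' n, φ (8 * 2 ^ n * t - 8) • (y n - x)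
    + ∑' n, ((8 * 2 ^ n * t - 8) * φ (8 * 2 ^ n * t - 8)) • z n, ?_, ?_, fun n => ?_⟩
  · exact (contDiff_const.add (contDiff_tsum_dyadic_smul φ.contDiff φ.hasCompactSupport hy)).add
      (contDiff_tsum_dyadic_smul (θ := fun t => t * φ t) (contDiff_id.mul φ.contDiff)
        φ.hasCompactSupport.mul_left hz)
  · simp [hφ0]
  · have hp : (0 : ℝ) < 2 ^ n := by positivity
    have h1 : Tendsto (fun t : ℝ => 8 * 2 ^ n * t - 8) (𝓝 (1 / 2 ^ n)) (𝓝 0) := by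
      have : ContinuousAt (fun t : ℝ => 8 * 2 ^ n * t - 8) (1 / 2 ^ n) := by fun_prop
      convert this.tendsto using 2
      field_simp
      norm_num
    filter_upwards [tsum_dyadic_smul_eventuallyEq hφ0 (fun n => y n - x) n,
      tsum_dyadic_smul_eventuallyEq (θ := fun t => t * φ t) hψ0 z n,
      h1.eventually φ.eventuallyEq_one] with t h2 h3 h4
    rw [h2, h3, h4]
    simp only [Pi.one_apply, one_smul, mul_one, z, smul_smul]
    rw [add_sub_cancel]
    congr 2
    field_simp

theorem tendsto_one_div_two_pow : Tendsto (fun n : ℕ => (1 : ℝ) / 2 ^ n) atTop (𝓝 0) := by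
  simpa [Function.comp_def] using tendsto_inv_atTop_zero.comp (tendsto_pow_atTop_atTop_of_one_lt (one_lt_two (α := ℝ)))

/-- Otherwise there are points violating `P` within `1 / n!` of `x`, and one smooth curve meets all
of them at the times `1 / 2 ^ n`. -/
theorem eventually_of_forall_curve [CompleteSpace V] {P : V → Prop} {x : V}
    (h : ∀ c : ℝ → V, ContDiff ℝ ∞ c → c 0 = x → ∀ᶠ t in 𝓝 0, P (c t)) : ∀ᶠ y in 𝓝 x, P y := by
  by_contra H
  have h1 : ∀ n : ℕ, ∃ y, ‖y - x‖ ≤ 1 / n.factorial ∧ ¬ P y := fun n => by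
    have h2 := (not_eventually.1 H).and_eventually
      (Metric.closedBall_mem_nhds x (show (0 : ℝ) < 1 / n.factorial by positivity))
    obtain ⟨y, hy, hy'⟩ := h2.exists
    exact ⟨y, by simpa [dist_eq_norm] using hy', hy⟩
  choose y hy hyP using h1
  obtain ⟨c, hc, hc0, hcn⟩ := exists_contDiff_curve_through 0 hy
  obtain ⟨n, hn⟩ := (tendsto_one_div_two_pow.eventually (h c hc hc0)).exists
  rw [(hcn n).eq_of_nhds] at hn
  exact hyP n (by simpa using hn)

theorem IsCInftyOpen.isOpen [CompleteSpace V] {s : Set V} (hs : IsCInftyOpen s) : IsOpen s := by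
  rw [isOpen_iff_eventually]
  refine fun x hx => eventually_of_forall_curve fun c hc h0 => ?_
  exact (hs c (isSmoothCurve_iff_contDiff.2 hc)).mem_nhds (by simpa [h0] using hx)

variable {f : V → ℝ}

theorem continuous_of_curvewise [CompleteSpace V]
    (hf : ∀ c : ℝ → V, ContDiff ℝ ∞ c → ContDiff ℝ ∞ (f ∘ c)) : Continuous f := by
  refine continuous_iff_continuousAt.2 fun x => ?_
  intro s hs
  refine eventually_of_forall_curve fun c hc h0 => ?_
  have := (hf c hc).continuous.continuousAt (x := 0)
  rw [ContinuousAt, Function.comp_apply, h0] at this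
  exact this hs

theorem contDiff_line (x v : V) : ContDiff ℝ ∞ fun s : ℝ => x + s • v := by fun_prop

/-- Suppose that the derivatives at some `y n → x` exceed `n * n! ^ k`. A smooth curve passing
through `y n` with velocity `v / n!` scales them by `(1 / n!) ^ k`, so the `k`-th derivative of `f ∘
c` is unbounded along `1 / 2 ^ n → 0`, against its continuity. -/
theorem exists_eventually_norm_iteratedDeriv_line_le [CompleteSpace V]
    (hf : ∀ c : ℝ → V, ContDiff ℝ ∞ c → ContDiff ℝ ∞ (f ∘ c)) (x v : V) (k : ℕ) :
    ∃ K, ∀ᶠ y in 𝓝 x, ‖iteratedDeriv k (fun s : ℝ => f (y + s • v)) 0‖ ≤ K := by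
  by_contra! H
  have h1 : ∀ n : ℕ, ∃ y, ‖y - x‖ ≤ 1 / n.factorial ∧
      (n : ℝ) * n.factorial ^ k < ‖iteratedDeriv k (fun s : ℝ => f (y + s • v)) 0‖ := fun n => by
    have h2 := (H (n * n.factorial ^ k)).and_eventually
      (Metric.closedBall_mem_nhds x (show (0 : ℝ) < 1 / n.factorial by positivity))
    obtain ⟨y, hy, hy'⟩ := h2.exists
    exact ⟨y, by simpa [dist_eq_norm] using hy', hy⟩
  choose y hy hyP using h1
  obtain ⟨c, hc, hc0, hcn⟩ := exists_contDiff_curve_through v hy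
  have hcont : Continuous (iteratedDeriv k (f ∘ c)) :=
    (hf c hc).continuous_iteratedDeriv k (by exact_mod_cast le_top)
  have hval : ∀ n : ℕ, iteratedDeriv k (f ∘ c) (1 / 2 ^ n) = (1 / n.factorial : ℝ) ^ k *
      iteratedDeriv k (fun s : ℝ => f (y n + s • v)) 0 := fun n => by
    have e : f ∘ c =ᶠ[𝓝 (1 / 2 ^ n)] fun t => (fun t => (fun s : ℝ => f (y n + s • v))
        ((1 / n.factorial : ℝ) * t)) (t - 1 / 2 ^ n) := by
      filter_upwards [hcn n] with t ht
      simp [ht]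
    rw [e.iteratedDeriv_eq, iteratedDeriv_comp_sub_const k (fun t => (fun s : ℝ => f (y n + s • v))
        ((1 / n.factorial : ℝ) * t))]
    beta_reduce
    rw [congrFun (iteratedDeriv_comp_const_mul (n := k) (f := fun s : ℝ => f (y n + s • v))
      ((hf _ (contDiff_line _ _)).of_le (by exact_mod_cast le_top)) _) _]
    simp
  have hlim := (hcont.tendsto 0).comp tendsto_one_div_two_pow
  obtain ⟨N, hN⟩ := ((hlim.norm.eventually_lt_const (lt_add_one _)).and
    (eventually_ge_atTop (Nat.ceil (‖iteratedDeriv k (f ∘ c) 0‖ + 1)))).exists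
  obtain ⟨h3, h4⟩ := hN
  have h5 := hyP N
  have h6 : (0 : ℝ) < N.factorial := by positivity
  rw [Function.comp_apply, hval, norm_mul, norm_pow, Real.norm_of_nonneg (by positivity),
    one_div, inv_pow, inv_mul_lt_iff₀ (by positivity)] at h3
  have h7 := Nat.ceil_le.1 h4
  have h8 : (0 : ℝ) < (N.factorial : ℝ) ^ k := by positivity
  nlinarith

theorem hasDerivAt_line_of_curvewise
    (hf : ∀ c : ℝ → V, ContDiff ℝ ∞ c → ContDiff ℝ ∞ (f ∘ c)) (v y : V) (s : ℝ) :
    HasDerivAt (fun s : ℝ => f (y + s • v)) (lineDeriv ℝ f (y + s • v) v) s := by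
  have h1 : DifferentiableAt ℝ (fun s : ℝ => f (y + s • v)) s :=
    (hf _ (contDiff_line y v)).differentiable (by simp) s
  have h2 := deriv_comp_add_const (fun s : ℝ => f (y + s • v)) s 0
  rw [zero_add] at h2
  have h3 : lineDeriv ℝ f (y + s • v) v = deriv (fun s : ℝ => f (y + s • v)) s := by
    rw [← h2]
    simp only [lineDeriv, add_smul, add_assoc, add_comm (s • v)]
  rw [h3]
  exact h1.hasDerivAt

/-- The local bound on second derivatives along `v` makes the Taylor error uniform in the base
point, so the derivative is a locally uniform limit of the difference quotients, which are
continuous. -/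
theorem continuous_lineDeriv_of_curvewise [CompleteSpace V]
    (hf : ∀ c : ℝ → V, ContDiff ℝ ∞ c → ContDiff ℝ ∞ (f ∘ c)) (v : V) :
    Continuous fun y => lineDeriv ℝ f y v := by
  have hd := hasDerivAt_line_of_curvewise hf v
  have hd2 : ∀ y (s : ℝ), HasDerivAt (fun s : ℝ => lineDeriv ℝ f (y + s • v) v)
      (iteratedDeriv 2 (fun t : ℝ => f (y + s • v + t • v)) 0) s := by
    intro y s
    have e : (fun s : ℝ => lineDeriv ℝ f (y + s • v) v) = deriv fun s : ℝ => f (y + s • v) :=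
      funext fun s => (hd y s).deriv.symm
    have h1 : DifferentiableAt ℝ (deriv fun s : ℝ => f (y + s • v)) s := by
      have := (hf _ (contDiff_line y v)).differentiable_iteratedDeriv 1
        (by exact_mod_cast ENat.natCast_lt_top 1)
      rw [iteratedDeriv_one] at this
      exact this s
    have h3 := congrFun (iteratedDeriv_comp_add_const 2 (fun s : ℝ => f (y + s • v)) s) 0
    rw [zero_add, iteratedDeriv_succ (f := fun s : ℝ => f (y + s • v)), iteratedDeriv_one] at h3
    have h4 : iteratedDeriv 2 (fun t : ℝ => f (y + s • v + t • v)) 0 =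
        deriv (deriv fun s : ℝ => f (y + s • v)) s := by
      rw [← h3]
      simp only [add_smul, add_assoc, add_comm (s • v)]
    rw [e, h4]
    exact h1.hasDerivAt
  refine continuous_iff_continuousAt.2 fun x => ?_
  obtain ⟨K, hK⟩ := exists_eventually_norm_iteratedDeriv_line_le hf x v 2
  have hK0 : 0 ≤ K := (norm_nonneg _).trans hK.self_of_nhds
  obtain ⟨δ, hδ, hb⟩ := Metric.eventually_nhds_iff.1 hK
  -- First order Taylor estimate, by the mean value inequality applied twice.
  have key : ∀ r : ℝ, 0 < r → r * ‖v‖ < δ / 2 → ∀ y, dist y x < δ / 2 →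
      ‖f (y + r • v) - f y - r * lineDeriv ℝ f y v‖ ≤ K * r * r := by
    intro r hr hrv y hy
    have hseg : ∀ s ∈ Icc (0 : ℝ) r, dist (y + s • v) x < δ := fun s hs => by
      calc dist (y + s • v) x ≤ dist (y + s • v) y + dist y x := dist_triangle _ _ _
        _ < δ / 2 + δ / 2 := by
          refine add_lt_add_of_le_of_lt ?_ hy
          rw [dist_self_add_left, norm_smul, Real.norm_of_nonneg hs.1]
          exact (mul_le_mul_of_nonneg_right hs.2 (norm_nonneg _)).trans hrv.le
        _ = δ := add_halves δ
    have h1 : ∀ s ∈ Icc (0 : ℝ) r, ‖lineDeriv ℝ f (y + s • v) v - lineDeriv ℝ f y v‖ ≤ K * r := by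
      intro s hs
      have := (convex_Icc (0 : ℝ) r).norm_image_sub_le_of_norm_hasDerivWithin_le
        (fun s _ => (hd2 y s).hasDerivWithinAt) (fun s hs => hb (hseg s hs))
        (left_mem_Icc.2 hr.le) hs
      rw [zero_smul, add_zero, sub_zero, Real.norm_of_nonneg hs.1] at this
      exact this.trans (mul_le_mul_of_nonneg_left hs.2 hK0)
    have := (convex_Icc (0 : ℝ) r).norm_image_sub_le_of_norm_hasDerivWithin_le
        (fun s _ => ((hd y s).sub ((hasDerivAt_id s).mul_const
          (lineDeriv ℝ f y v))).hasDerivWithinAt) (fun s hs => by simpa using h1 s hs)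
        (left_mem_Icc.2 hr.le) (right_mem_Icc.2 hr.le)
    rw [sub_zero, Real.norm_of_nonneg hr.le] at this
    refine le_trans (le_of_eq ?_) this
    congr 1
    simp
    ring
  have hfc := continuous_of_curvewise hf
  rw [Metric.continuousAt_iff']
  intro ε hε
  -- After division by `r`, the Taylor errors at `x` and `y` and the variation of the difference
  -- quotient each cost less than `ε / 4`.
  obtain ⟨r, hr, hr1, hr2⟩ : ∃ r : ℝ, 0 < r ∧ r * ‖v‖ < δ / 2 ∧ K * r < ε / 4 := by
    have h1 : Tendsto (fun r : ℝ => r * ‖v‖) (𝓝[>] 0) (𝓝 0) :=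
      (Continuous.tendsto' (by fun_prop) 0 0 (by simp)).mono_left nhdsWithin_le_nhds
    have h2 : Tendsto (fun r : ℝ => K * r) (𝓝[>] 0) (𝓝 0) :=
      (Continuous.tendsto' (by fun_prop) 0 0 (by simp)).mono_left nhdsWithin_le_nhds
    obtain ⟨r, ⟨h3, h4⟩, h5⟩ := (((h1.eventually_lt_const (half_pos hδ)).and
      (h2.eventually_lt_const (show 0 < ε / 4 by positivity))).and self_mem_nhdsWithin).exists
    exact ⟨r, h5, h3, h4⟩
  have hg : Continuous fun y => f (y + r • v) - f y := by fun_prop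
  filter_upwards [Metric.ball_mem_nhds x (half_pos hδ),
    Metric.continuousAt_iff'.1 (hg.continuousAt (x := x)) (r * (ε / 4)) (by positivity)]
    with y hy hy2
  have h1 := key r hr hr1 y hy
  have h2 := key r hr hr1 x (by simpa using half_pos hδ)
  rw [Real.dist_eq] at hy2 ⊢
  rw [Real.norm_eq_abs] at h1 h2
  refine lt_of_mul_lt_mul_left ?_ hr.le
  have h3 : K * r * r < r * (ε / 4) := by nlinarith
  rw [← abs_of_pos hr, ← abs_mul, abs_of_pos hr]
  rw [abs_le] at h1 h2
  rw [abs_lt] at hy2 ⊢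
  have : 0 < r * ε := by positivity
  constructor <;> nlinarith

/-- The first order part of Boman's theorem. -/
theorem differentiable_of_curvewise [FiniteDimensional ℝ V]
    (hf : ∀ c : ℝ → V, ContDiff ℝ ∞ c → ContDiff ℝ ∞ (f ∘ c)) : Differentiable ℝ f := by
  have := FiniteDimensional.complete ℝ V
  intro x
  let b := Module.finBasis ℝ V
  let L : V →L[ℝ] ℝ := LinearMap.toContinuousLinearMap (b.constr ℝ fun i => lineDeriv ℝ f x (b i))
  have hcont : ∀ i, Continuous (b.coord i) := fun i => LinearMap.continuous_of_finiteDimensional _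
  -- The basis directions are added one at a time, as in the proof that continuous partial
  -- derivatives imply differentiability.
  have key : ∀ s : Finset (Fin (Module.finrank ℝ V)),
      (fun h : V => f (x + ∑ i ∈ s, b.coord i h • b i) - f x
        - ∑ i ∈ s, b.coord i h * lineDeriv ℝ f x (b i)) =o[𝓝 0] fun h => h := by
    intro s
    induction s using Finset.induction_on with
    | empty => simp
    | insert a s ha ih =>
      have hG : ContinuousAt (fun q : V × ℝ => lineDeriv ℝ f
          (x + ∑ i ∈ s, b.coord i q.1 • b i + q.2 • b a) (b a)) 0 := by
        refine ((continuous_lineDeriv_of_curvewise hf (b a)).comp ?_).continuousAt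
        refine (continuous_const.add (continuous_finsetSum _ fun i _ => ?_)).add (by fun_prop)
        exact ((hcont i).comp continuous_fst).smul continuous_const
      have hstep : (fun h : V => f (x + ∑ i ∈ s, b.coord i h • b i + b.coord a h • b a)
          - f (x + ∑ i ∈ s, b.coord i h • b i) - b.coord a h * lineDeriv ℝ f x (b a))
          =o[𝓝 0] fun h => h := by
        refine Asymptotics.IsLittleO.trans_isBigO ?_ (Asymptotics.isBigO_of_le' (g := fun h : V => h)
          (f := fun h => b.coord a h) (c := ‖LinearMap.toContinuousLinearMap (b.coord a)‖) _
          fun h => (LinearMap.toContinuousLinearMap (b.coord a)).le_opNorm h)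
        refine Asymptotics.isLittleO_iff.2 fun ε hε => ?_
        obtain ⟨δ, hδ, hb⟩ := Metric.continuousAt_iff.1 hG ε hε
        have h0 : Tendsto (b.coord a) (𝓝 0) (𝓝 0) := (hcont a).tendsto' _ _ (map_zero _)
        filter_upwards [Metric.ball_mem_nhds (0 : V) hδ, h0 (Metric.ball_mem_nhds 0 hδ)]
          with h hh ha'
        have hbd : ∀ z ∈ Metric.ball (0 : ℝ) δ, ‖lineDeriv ℝ f
            (x + ∑ i ∈ s, b.coord i h • b i + z • b a) (b a) - lineDeriv ℝ f x (b a)‖ ≤ ε := by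
          intro z hz
          have := hb (x := (h, z)) (by rw [Prod.dist_eq]; exact max_lt hh hz)
          simp only [Prod.fst_zero, Prod.snd_zero, map_zero, zero_smul, Finset.sum_const_zero,
            add_zero, dist_eq_norm] at this
          exact this.le
        have := (convex_ball (0 : ℝ) δ).norm_image_sub_le_of_norm_hasDerivWithin_le
          (fun z _ => ((hasDerivAt_line_of_curvewise hf (b a)
            (x + ∑ i ∈ s, b.coord i h • b i) z).sub ((hasDerivAt_id z).mul_const
            (lineDeriv ℝ f x (b a)))).hasDerivWithinAt) (fun z hz => by simpa using hbd z hz)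
          (Metric.mem_ball_self hδ) ha'
        rw [sub_zero] at this
        refine le_trans (le_of_eq ?_) this
        congr 1
        simp
        ring
      refine (hstep.add ih).congr_left fun h => ?_
      simp only [Finset.sum_insert ha]
      rw [add_comm (b.coord a h • b a), ← add_assoc]
      ring
  refine ⟨L, ?_⟩
  rw [hasFDerivAt_iff_isLittleO_nhds_zero]
  refine (key Finset.univ).congr_left fun h => ?_
  have h1 : ∑ i, b.coord i h • b i = h := b.sum_repr h
  have h2 : L h = ∑ i, b.coord i h * lineDeriv ℝ f x (b i) := by
    simp [L, Module.Basis.constr_apply_fintype]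
  rw [h1, h2]

end CurvewiseSmoothFunctions

/-! ### Calculus of smooth curves in topological vector spaces -/

section SmoothCurves

/-- Carathéodory's form of the derivative. It has no exceptional point, so the chain rule needs no
division by `φ s - φ t`, which may vanish. -/
theorem sub_smul_update_slope {E : Type*} [AddCommGroup E] [Module ℝ E] (f : ℝ → E) (f' : E) (t s : ℝ) :
    f s - f t = (s - t) • Function.update (slope f t) t f' s := by
  rcases eq_or_ne s t with rfl | h
  · simp
  · rw [Function.update_of_ne h, sub_smul_slope]
    rfl

variable {E F : Type*} [AddCommGroup E] [Module ℝ E] [TopologicalSpace E]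
  [AddCommGroup F] [Module ℝ F] [TopologicalSpace F]

theorem continuousAt_of_tendsto_slope [ContinuousAdd E] [ContinuousSMul ℝ E] {f : ℝ → E} {f' : E}
    {t : ℝ} (hf : Tendsto (slope f t) (𝓝[≠] t) (𝓝 f')) : ContinuousAt f t := by
  have h1 : f = fun s => (s - t) • Function.update (slope f t) t f' s + f t := by
    funext s
    rw [← sub_smul_update_slope, sub_add_cancel]
  rw [h1]
  have h2 : ContinuousAt (Function.update (slope f t) t f') t := continuousAt_update_same.2 hf
  have h3 : ContinuousAt (fun s : ℝ => s - t) t := by fun_prop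
  exact (h3.smul h2).add continuousAt_const

theorem tendsto_slope_comp [ContinuousSMul ℝ E] {f : ℝ → E} {f' : E} {φ : ℝ → ℝ} {φ' t : ℝ}
    (hf : Tendsto (slope f (φ t)) (𝓝[≠] (φ t)) (𝓝 f')) (hφ : HasDerivAt φ φ' t) :
    Tendsto (slope (f ∘ φ) t) (𝓝[≠] t) (𝓝 (φ' • f')) := by
  have h1 : slope (f ∘ φ) t =
      fun s => slope φ t s • Function.update (slope f (φ t)) (φ t) f' (φ s) := by
    funext s
    have := sub_smul_update_slope f f' (φ t) (φ s)
    simp only [slope_def_module, Function.comp_apply] at this ⊢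
    rw [this, smul_smul, smul_eq_mul]
  have h2 : ContinuousAt (Function.update (slope f (φ t)) (φ t) f') (φ t) :=
    continuousAt_update_same.2 hf
  have h3 := (h2.comp hφ.continuousAt).tendsto.mono_left (nhdsWithin_le_nhds (s := {t}ᶜ))
  rw [Function.comp_apply, Function.update_self] at h3
  rw [h1]
  exact (hasDerivAt_iff_tendsto_slope.1 hφ).smul h3

theorem tendsto_slope_smul [ContinuousAdd E] [ContinuousSMul ℝ E] {a : ℝ → ℝ} {a' t : ℝ}
    {f : ℝ → E} {f' : E} (ha : HasDerivAt a a' t) (hf : Tendsto (slope f t) (𝓝[≠] t) (𝓝 f')) :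
    Tendsto (slope (fun s => a s • f s) t) (𝓝[≠] t) (𝓝 (a' • f t + a t • f')) := by
  have h1 : slope (fun s => a s • f s) t = fun s => slope a t s • f s + a t • slope f t s := by
    funext s
    simp only [slope_def_module, smul_eq_mul, mul_smul, sub_smul, smul_sub, smul_comm (a t)]
    abel
  rw [h1]
  exact ((hasDerivAt_iff_tendsto_slope.1 ha).smul
    ((continuousAt_of_tendsto_slope hf).tendsto.mono_left nhdsWithin_le_nhds)).add
    (tendsto_const_nhds.smul hf)

/-- Choosing derivatives inside `S` and iterating produces the whole sequence of derivatives, with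
no explicit formula for them. -/
theorem isSmoothCurve_of_mem {S : Set (ℝ → E)}
    (hS : ∀ f ∈ S, ∃ f' ∈ S, ∀ t, Tendsto (slope f t) (𝓝[≠] t) (𝓝 (f' t)))
    {c : ℝ → E} (hc : c ∈ S) : IsSmoothCurve c := by
  choose! der hmem hder using hS
  have h : ∀ k, der^[k] c ∈ S := fun k => by
    induction k with
    | zero => exact hc
    | succ k ih => rw [Function.iterate_succ_apply']; exact hmem _ ih
  refine ⟨fun k => der^[k] c, rfl, fun k t => ?_⟩
  beta_reduce
  rw [Function.iterate_succ_apply']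
  exact hder _ (h k) t

/-- Sums of curves `a t • D k (φ t)` with `a` smooth are closed under differentiation, since such a
term has derivative `a' • D k ∘ φ + (a * φ') • D (k + 1) ∘ φ`. -/
theorem IsSmoothCurve.comp_contDiff [ContinuousAdd E] [ContinuousSMul ℝ E] {c : ℝ → E}
    (hc : IsSmoothCurve c) {φ : ℝ → ℝ} (hφ : ContDiff ℝ ∞ φ) : IsSmoothCurve (c ∘ φ) := by
  obtain ⟨D, rfl, hD⟩ := hc
  let G : Set (ℝ → E) := {f | ∃ (a : ℝ → ℝ) (k : ℕ), ContDiff ℝ ∞ a ∧ f = fun t => a t • D k (φ t)}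
  have hφ' : ContDiff ℝ ∞ (deriv φ) := (contDiff_infty_iff_deriv.1 hφ).2
  have key : ∀ f ∈ AddSubmonoid.closure G, ∃ f' ∈ AddSubmonoid.closure G,
      ∀ t, Tendsto (slope f t) (𝓝[≠] t) (𝓝 (f' t)) := by
    intro f hf
    induction hf using AddSubmonoid.closure_induction with
    | mem f hf =>
      obtain ⟨a, k, ha, rfl⟩ := hf
      have ha' : ContDiff ℝ ∞ (deriv a) := (contDiff_infty_iff_deriv.1 ha).2
      refine ⟨(fun t => deriv a t • D k (φ t)) + fun t => (a t * deriv φ t) • D (k + 1) (φ t),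
        add_mem (AddSubmonoid.subset_closure ⟨_, _, ha', rfl⟩)
          (AddSubmonoid.subset_closure ⟨_, _, ha.mul hφ', rfl⟩), fun t => ?_⟩
      have h1 := tendsto_slope_comp (hD k (φ t)) (hφ.differentiable (by simp) t).hasDerivAt
      have h2 := tendsto_slope_smul (ha.differentiable (by simp) t).hasDerivAt h1
      rw [smul_smul] at h2
      exact h2
    | zero =>
      refine ⟨0, zero_mem _, fun t => ?_⟩
      have : slope (0 : ℝ → E) t = fun _ => 0 := by funext s; simp [slope]
      rw [this]
      exact tendsto_const_nhds
    | add f g _ _ hf hg =>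
      obtain ⟨f', hf', hf⟩ := hf
      obtain ⟨g', hg', hg⟩ := hg
      refine ⟨f' + g', add_mem hf' hg', fun t => ?_⟩
      have : slope (f + g) t = fun s => slope f t s + slope g t s := by
        funext s
        simp only [slope_def_module, Pi.add_apply, ← smul_add]
        congr 1
        abel
      rw [this]
      exact (hf t).add (hg t)
  refine isSmoothCurve_of_mem key (AddSubmonoid.subset_closure ⟨fun _ => 1, 0, contDiff_const, ?_⟩)
  funext t
  simp

theorem IsSmoothCurve.continuousLinearMap_comp {c : ℝ → E} (hc : IsSmoothCurve c) (T : E →L[ℝ] F) :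
    IsSmoothCurve (T ∘ c) := by
  obtain ⟨D, rfl, hD⟩ := hc
  refine ⟨fun k => T ∘ D k, rfl, fun k t => ?_⟩
  have : slope (T ∘ D k) t = T ∘ slope (D k) t := by
    funext s
    simp [slope_def_module]
  rw [this]
  exact (T.continuous.tendsto _).comp (hD k t)

theorem IsSmoothCurve.const_add {c : ℝ → E} (hc : IsSmoothCurve c) (x : E) :
    IsSmoothCurve fun t => x + c t := by
  obtain ⟨D, rfl, hD⟩ := hc
  refine ⟨fun k => if k = 0 then fun t => x + D 0 t else D k, rfl, fun k t => ?_⟩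
  rcases eq_or_ne k 0 with rfl | hk
  · have : slope (fun t => x + D 0 t) t = slope (D 0) t := by
      funext s
      simp [slope_def_module]
    simpa [this] using hD 0 t
  · simpa [hk] using hD k t

theorem isSmoothCurve_const_add_linearMap [IsTopologicalAddGroup E] [ContinuousSMul ℝ E]
    {V : Type*} [NormedAddCommGroup V] [NormedSpace ℝ V] [FiniteDimensional ℝ V] (x : E)
    (T : V →ₗ[ℝ] E) {c : ℝ → V} (hc : ContDiff ℝ ∞ c) : IsSmoothCurve fun t => x + T (c t) :=
  ((isSmoothCurve_iff_contDiff.2 hc).continuousLinearMap_comp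
    ⟨T, T.continuous_of_finiteDimensional⟩).const_add x

end SmoothCurves

/-- Smooth self-maps of a vector space that are the identity near `x` and have values in a given
neighbourhood of `x`. -/
theorem exists_contDiff_localizer {V : Type*} [NormedAddCommGroup V] [InnerProductSpace ℝ V]
    {x : V} {N : Set V} (hN : N ∈ 𝓝 x) :
    ∃ φ : V → V, ContDiff ℝ ∞ φ ∧ φ =ᶠ[𝓝 x] id ∧ ∀ s, φ s ∈ N := by
  obtain ⟨δ, hδ, hb⟩ := Metric.mem_nhds_iff.1 hN
  let ψ : ContDiffBump x := ⟨δ / 4, δ / 2, by positivity, by linarith⟩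
  refine ⟨fun s => x + ψ s • (s - x), ?_, ?_, fun s => hb ?_⟩
  · exact contDiff_const.add (ψ.contDiff.smul (contDiff_id.sub contDiff_const))
  · filter_upwards [ψ.eventuallyEq_one] with s hs
    simp [hs]
  · rw [Metric.mem_ball, dist_self_add_left, norm_smul, Real.norm_of_nonneg ψ.nonneg]
    by_cases h : ‖s - x‖ < δ
    · calc ψ s * ‖s - x‖ ≤ 1 * ‖s - x‖ := by gcongr; exact ψ.le_one
        _ < δ := by linarith
    · have : ψ s = 0 := ψ.zero_of_le_dist (by
        change δ / 2 ≤ dist s x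
        rw [dist_eq_norm]; linarith)
      rw [this]; simpa using hδ

/-- The quotient by the line of `v` still has rank at least `d`, also when the rank is infinite. An
injection into it is lifted by a linear section. -/
theorem exists_linearMap_transverse {E : Type*} [AddCommGroup E] [Module ℝ E] {d : ℕ}
    (hd : (d : Cardinal) < Module.rank ℝ E) (v : E) :
    ∃ T : EuclideanSpace ℝ (Fin d) →ₗ[ℝ] E, ∀ u (a : ℝ), T u = a • v → u = 0 := by
  let S : Submodule ℝ E := Submodule.span ℝ {v}
  have h1 : (d : Cardinal) ≤ Module.rank ℝ (E ⧸ S) := by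
    by_contra! h
    obtain ⟨m, hm⟩ := Cardinal.lt_aleph0.1 (h.trans (Cardinal.natCast_lt_aleph0))
    have h2 := S.rank_quotient_add_rank
    have h3 : Module.rank ℝ S ≤ 1 := by simpa using rank_span_le (R := ℝ) ({v} : Set E)
    rw [hm] at h h2
    have h4 : m + 1 ≤ d := by exact_mod_cast h
    have h5 : Module.rank ℝ E ≤ d := by
      rw [← h2]
      calc (m : Cardinal) + Module.rank ℝ S ≤ m + 1 := by gcongr
        _ ≤ d := by exact_mod_cast h4
    exact absurd hd h5.not_gt
  obtain ⟨f, hf⟩ := Module.le_rank_iff_exists_linearMap.1 h1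
  obtain ⟨σ, hσ⟩ := S.mkQ.exists_rightInverse_of_surjective S.range_mkQ
  refine ⟨σ ∘ₗ f ∘ₗ (WithLp.linearEquiv 2 ℝ (Fin d → ℝ)).toLinearMap, fun u a h => ?_⟩
  have h2 := congrArg S.mkQ h
  have h3 : S.mkQ (a • v) = 0 := by
    rw [Submodule.mkQ_apply, Submodule.Quotient.mk_eq_zero]
    exact S.smul_mem a (Submodule.mem_span_singleton_self v)
  have h4 := LinearMap.congr_fun hσ (f (WithLp.linearEquiv 2 ℝ (Fin d → ℝ) u))
  simp only [LinearMap.comp_apply, LinearMap.id_apply, LinearEquiv.coe_coe] at h2 h4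
  rw [h3, h4] at h2
  have h5 := hf (h2.trans (map_zero f).symm)
  simpa using h5

/-! ### Plots of manifolds and of their skeletal diffeologies -/

section Plots

open Diffeology

variable {ι : Type*} {E : ι → Type*} [∀ i, AddCommGroup (E i)] [∀ i, Module ℝ (E i)]
  [∀ i, TopologicalSpace (E i)] {M X : Type*}

theorem isPlot_manifoldDiffeology_iff [∀ i, T2Space (E i)] {A : SmoothAtlas E M} {n : ℕ}
    {p : EuclideanSpace ℝ (Fin n) → M} :
    @IsPlot _ (manifoldDiffeology A) n p ↔
      ∀ j, IsCInftyOpen (p ⁻¹' (A.chart j).source) ∧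
        IsConvSmoothOn (A.chart j ∘ p) (p ⁻¹' (A.chart j).source) := by
  have h : @IsPlot _ (manifoldDiffeology A) n p ↔ IsSmoothMapOn (selfAtlas _) A p univ := Iff.rfl
  rw [h, isSmoothMapOn_selfAtlas]
  simp only [univ_inter]

/-- In the chart `j` this is a change of charts applied to `h`. Smoothness of `h` is asked along
curves only, because `E i` carries no norm. -/
theorem isPlot_chart_symm_comp [∀ i, T2Space (E i)] (A : SmoothAtlas E M) {n : ℕ} {i : ι}
    {h : EuclideanSpace ℝ (Fin n) → E i}
    (hh : ∀ c : ℝ → EuclideanSpace ℝ (Fin n), ContDiff ℝ ∞ c → IsSmoothCurve (h ∘ c))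
    (ht : ∀ x, h x ∈ (A.chart i).target) :
    @IsPlot _ (manifoldDiffeology A) n ((A.chart i).symm ∘ h) := by
  have hmem : ∀ (j : ι) (x : EuclideanSpace ℝ (Fin n)),
      h x ∈ ((A.chart i).symm.trans (A.chart j)).source ↔
        (A.chart i).symm (h x) ∈ (A.chart j).source := fun j x => by
    rw [PartialEquiv.trans_source]
    exact and_iff_right (ht x)
  refine isPlot_manifoldDiffeology_iff.2 fun j => ⟨fun c hc => ?_, fun c hc hcm => ?_⟩
  · convert A.isCInftyOpen_change i j _ (hh c (isSmoothCurve_iff_contDiff.1 hc)) using 1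
    ext t
    exact (hmem j (c t)).symm
  · exact A.smooth_change i j _ (hh c (isSmoothCurve_iff_contDiff.1 hc))
      fun t => (hmem j (c t)).2 (hcm t)

/-- A smooth map of manifolds maps plots to plots. -/
theorem IsSmoothMap.isPlot_comp [∀ i, T2Space (E i)] {A : SmoothAtlas E M} {f : M → M}
    (hf : IsSmoothMap A A f) {n : ℕ} {p : EuclideanSpace ℝ (Fin n) → M}
    (hp : @IsPlot _ (manifoldDiffeology A) n p) : @IsPlot _ (manifoldDiffeology A) n (f ∘ p) := by
  rw [isPlot_manifoldDiffeology_iff] at hp ⊢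
  -- A curve may leave the chart domain; it is reparametrized to stay in one chart without changing
  -- it near `t`.
  have key : ∀ (c : ℝ → EuclideanSpace ℝ (Fin n)) (t : ℝ), IsSmoothCurve c →
      ∃ (i : ι) (φ : ℝ → ℝ), φ =ᶠ[𝓝 t] id ∧ (∀ s, p (c (φ s)) ∈ (A.chart i).source) ∧
        IsSmoothCurve fun s => A.chart i (p (c (φ s))) := by
    intro c t hc
    obtain ⟨i, hi⟩ := A.cover (p (c t))
    obtain ⟨φ, hφ, hφt, hφN⟩ := exists_localizer (((hp i).1 c hc).mem_nhds hi)
    exact ⟨i, φ, hφt, hφN, (hp i).2 (c ∘ φ) (isSmoothCurve_iff_contDiff.2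
      ((isSmoothCurve_iff_contDiff.1 hc).comp hφ)) hφN⟩
  have hmem : ∀ i j x, x ∈ (A.chart i).source →
      (A.chart i x ∈ localDomain A A f univ i j ↔ f x ∈ (A.chart j).source) := by
    intro i j x hx
    simp [localDomain, (A.chart i).left_inv hx, (A.chart i).map_source hx]
  refine fun j => ⟨fun c hc => isOpen_iff_mem_nhds.2 fun t ht => ?_,
    fun c hc hcm => isSmoothCurve_of_local fun t => ?_⟩
  · obtain ⟨i, φ, hφt, hφs, hs⟩ := key c t hc
    have ho := (hf i j).1 _ hs
    have h1 : φ t = t := hφt.eq_of_nhds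
    filter_upwards [ho.mem_nhds (x := t) ((hmem i j _ (hφs t)).2 (by rw [h1]; exact ht)), hφt]
      with s hs' hs2
    have := (hmem i j _ (hφs s)).1 hs'
    rwa [hs2] at this
  · obtain ⟨i, φ, hφt, hφs, hs⟩ := key c t hc
    refine ⟨_, (hf i j).2 _ hs fun s => (hmem i j _ (hφs s)).2 (hcm _), ?_⟩
    filter_upwards [hφt] with s hs2
    simp only [Function.comp_apply, (A.chart i).left_inv (hφs s)]
    rw [hs2]
    rfl

/-- A map that maps smooth curves to smooth curves is a smooth map of manifolds. -/
theorem isSmoothMap_of_isPlot_comp [∀ i, ConvenientSpace (E i)] {A : SmoothAtlas E M} {f : M → M}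
    (hf : ∀ p : EuclideanSpace ℝ (Fin 1) → M, @IsPlot _ (manifoldDiffeology A) 1 p →
      @IsPlot _ (manifoldDiffeology A) 1 (f ∘ p)) : IsSmoothMap A A f := by
  let e : ℝ → EuclideanSpace ℝ (Fin 1) := fun t => WithLp.toLp 2 fun _ => t
  have he : ContDiff ℝ ∞ e := by
    rw [contDiff_euclidean]
    exact fun _ => contDiff_id
  have hes : IsSmoothCurve e := isSmoothCurve_iff_contDiff.2 he
  have key : ∀ (i : ι) (c : ℝ → E i), IsSmoothCurve c → (∀ t, c t ∈ (A.chart i).target) →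
      @IsPlot _ (manifoldDiffeology A) 1 (f ∘ (A.chart i).symm ∘ fun z => c (z 0)) := by
    intro i c hc hct
    refine hf _ (isPlot_chart_symm_comp A (fun b hb => ?_) fun z => hct _)
    exact hc.comp_contDiff (φ := fun t => b t 0) (contDiff_euclidean.1 hb 0)
  refine fun i j => ⟨fun c hc => isOpen_iff_mem_nhds.2 fun t ht => ?_, fun c hc hcm => ?_⟩
  · have hN := (A.isCInftyOpen_target i c hc).mem_nhds ht.1
    obtain ⟨φ, hφ, hφt, hφN⟩ := exists_localizer hN
    have h1 := (isPlot_manifoldDiffeology_iff.1 (key i _ (hc.comp_contDiff hφ) hφN) j).1 e hes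
    have h2 : φ t = t := hφt.eq_of_nhds
    filter_upwards [h1.mem_nhds (x := t) (by simpa [e, h2] using ht.2.2), hφt, hN] with s h3 h4 h5
    refine ⟨h5, mem_univ _, ?_⟩
    simpa [e, h4] using h3
  · exact (isPlot_manifoldDiffeology_iff.1 (key i _ hc fun t => (hcm t).1) j).2 e hes
      fun t => (hcm t).2.2

theorem skeletal_le (d : ℕ) (D : DiffeologicalSpace X) : skeletal d D ≤ D :=
  DiffeologicalSpace.generateFrom_le_iff_subset_toPlots.2 fun _ h => h.1

theorem isPlot_skeletal {d : ℕ} {D : DiffeologicalSpace X} {n : ℕ}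
    {p : EuclideanSpace ℝ (Fin n) → X} (hp : @IsPlot _ D n p) (hn : n ≤ d) :
    @IsPlot _ (skeletal d D) n p :=
  DiffeologicalSpace.isPlot_generatedFrom_of_mem ⟨hp, hn⟩

theorem isPlot_of_skeletal {d : ℕ} {D : DiffeologicalSpace X} {n : ℕ}
    {p : EuclideanSpace ℝ (Fin n) → X} (hp : @IsPlot _ (skeletal d D) n p) : @IsPlot _ D n p :=
  DiffeologicalSpace.le_iff'.1 (skeletal_le d D) n p hp

/-- It suffices to check the generating plots, as the pullback diffeology along `f` contains
everything they generate. -/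
theorem dSmooth_skeletal (d : ℕ) {D : DiffeologicalSpace X} {f : X → X}
    (hf : @DSmooth X X D D f) : @DSmooth X X (skeletal d D) (skeletal d D) f := by
  have h : skeletal d D ≤ initial f (skeletal d D) :=
    DiffeologicalSpace.generateFrom_le_iff.2 fun n p hp => isPlot_skeletal (hf n p hp.1) hp.2
  exact fun n p hp => DiffeologicalSpace.le_iff'.1 h n p hp

theorem mem_aut_skeletal_iff [∀ i, ConvenientSpace (E i)] (A : SmoothAtlas E M) {d : ℕ}
    (hd : 0 < d) (f : Equiv.Perm M) :
    f ∈ aut (skeletal d (manifoldDiffeology A)) ↔ IsManifoldDiffeo A f :=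
  ⟨fun h => ⟨isSmoothMap_of_isPlot_comp fun _ hp =>
      isPlot_of_skeletal (h.1 _ _ (isPlot_skeletal hp hd)),
    isSmoothMap_of_isPlot_comp fun _ hp =>
      isPlot_of_skeletal (h.2 _ _ (isPlot_skeletal hp hd))⟩,
   fun h => ⟨dSmooth_skeletal d fun _ _ hp => h.1.isPlot_comp hp,
    dSmooth_skeletal d fun _ _ hp => h.2.isPlot_comp hp⟩⟩

/-- The diffeology of the maps that locally factor through plots of dimension at most `d`. -/
@[reducible]
def factorDiffeology (d : ℕ) (D : DiffeologicalSpace X) : DiffeologicalSpace X where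
  plots n := {p | ∀ x, ∃ k ≤ d, ∃ P ∈ D.plots k, ∃ g : EuclideanSpace ℝ (Fin n) →
    EuclideanSpace ℝ (Fin k), ContDiff ℝ ∞ g ∧ p =ᶠ[𝓝 x] P ∘ g}
  constant_plots x _ := ⟨0, Nat.zero_le d, _, D.constant_plots x, fun _ => 0, contDiff_const,
    Eventually.of_forall fun _ => rfl⟩
  plot_reparam {n m p f} hp hf x := by
    obtain ⟨k, hk, P, hP, g, hg, h⟩ := hp (f x)
    exact ⟨k, hk, P, hP, g ∘ f, hg.comp hf, hf.continuous.continuousAt.eventually h⟩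
  locality {n p} h x := by
    obtain ⟨u, hu, hxu, H⟩ := h x
    -- The hypothesis `H` accepts only globally defined reparametrizations with values in `u`, so
    -- the inclusion of `u` is replaced by one that is the identity near `x`.
    obtain ⟨φ, hφ, hφx, hφu⟩ := exists_contDiff_localizer (hu.mem_nhds hxu)
    obtain ⟨k, hk, P, hP, g, hg, h'⟩ := H hφu hφ x
    refine ⟨k, hk, P, hP, g, hg, ?_⟩
    filter_upwards [h', hφx] with y h1 h2
    rw [← h1, Function.comp_apply, h2, id]

/-- The parametrizations that factor in this way form a diffeology that contains the generators.
This turns the bound on dimensions into a bound on rank. -/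
theorem exists_factor_of_isPlot_skeletal {d : ℕ} {D : DiffeologicalSpace X} {n : ℕ}
    {p : EuclideanSpace ℝ (Fin n) → X} (hp : @IsPlot _ (skeletal d D) n p)
    (x : EuclideanSpace ℝ (Fin n)) :
    ∃ k ≤ d, ∃ P : EuclideanSpace ℝ (Fin k) → X, @IsPlot _ D k P ∧
      ∃ g : EuclideanSpace ℝ (Fin n) → EuclideanSpace ℝ (Fin k), ContDiff ℝ ∞ g ∧
        p =ᶠ[𝓝 x] P ∘ g := by
  have h : skeletal d D ≤ factorDiffeology d D :=
    DiffeologicalSpace.generateFrom_le_iff.2 fun n p hp x =>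
      ⟨n, hp.2, p, hp.1, id, contDiff_id, Eventually.of_forall fun _ => rfl⟩
  exact DiffeologicalSpace.le_iff'.1 h n p hp x

/-- A cutoff near `a` and the functional `l` reduce the claim to a scalar function on a Euclidean
space that is smooth along curves. -/
theorem differentiableAt_chart_comp [∀ i, ConvenientSpace (E i)] {A : SmoothAtlas E M} {k : ℕ}
    {P : EuclideanSpace ℝ (Fin k) → M} (hP : @IsPlot _ (manifoldDiffeology A) k P) {i : ι}
    {a : EuclideanSpace ℝ (Fin k)} (ha : P a ∈ (A.chart i).source) (l : E i →L[ℝ] ℝ) :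
    DifferentiableAt ℝ (fun y => l (A.chart i (P y))) a := by
  have h := isPlot_manifoldDiffeology_iff.1 hP i
  obtain ⟨ρ, hρ, hρa, hρs⟩ := exists_contDiff_localizer (h.1.isOpen.mem_nhds ha)
  have h1 : Differentiable ℝ fun y => l (A.chart i (P (ρ y))) := by
    refine differentiable_of_curvewise fun c hc => isSmoothCurve_iff_contDiff.1 ?_
    exact (h.2 (ρ ∘ c) (isSmoothCurve_iff_contDiff.2 (hρ.comp hc))
      fun t => hρs _).continuousLinearMap_comp l
  refine (h1 a).congr_of_eventuallyEq ?_
  filter_upwards [hρa] with y hy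
  rw [hy, id]

end Plots

/-! ### Rank obstruction and discreteness of the automorphism group -/

section Discreteness

open Diffeology

variable {ι : Type*} {E : ι → Type*} [∀ i, AddCommGroup (E i)] [∀ i, Module ℝ (E i)]
  [∀ i, TopologicalSpace (E i)] [∀ i, ConvenientSpace (E i)] {M : Type*}

/-- If `Φ (a, u)` factors locally through a parametrization of dimension at most `dim V`, then
`∂Φ/∂a` cannot be transverse to the injective image of `∂Φ/∂u`. -/
theorem not_factor_of_transverse {E V W Y : Type*} [AddCommGroup E] [Module ℝ E]
    [TopologicalSpace E] [SeparatingDual ℝ E] [NormedAddCommGroup V] [NormedSpace ℝ V]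
    [FiniteDimensional ℝ V] [NormedAddCommGroup W] [NormedSpace ℝ W] [FiniteDimensional ℝ W]
    [NormedAddCommGroup Y] [NormedSpace ℝ Y] [FiniteDimensional ℝ Y]
    (hYV : Module.finrank ℝ Y ≤ Module.finrank ℝ V) (Λ : W ≃L[ℝ] ℝ × V) {Φ : W → E} {Q : Y → E}
    {g : W → Y} (hg : DifferentiableAt ℝ g 0) (hΦ : Φ =ᶠ[𝓝 0] Q ∘ g)
    (hQ : ∀ l : E →L[ℝ] ℝ, DifferentiableAt ℝ (fun y => l (Q y)) (g 0)) {v : E} {T : V →ₗ[ℝ] E}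
    (hT : ∀ u (a : ℝ), T u = a • v → u = 0)
    (hv : ∀ l : E →L[ℝ] ℝ, HasDerivAt (fun a : ℝ => l (Φ (Λ.symm (a, 0)))) (l v) 0)
    (hu : ∀ (l : E →L[ℝ] ℝ) (u : V),
      HasDerivAt (fun s : ℝ => l (Φ (Λ.symm (0, s • u)))) (l (T u)) 0) : v = 0 := by
  have hlt : Module.finrank ℝ Y < Module.finrank ℝ W := by
    rw [Λ.toLinearEquiv.finrank_eq, Module.finrank_prod, Module.finrank_self]
    omega
  -- As `dim Y ≤ dim V < dim W`, the derivative of `g` kills some `ξ ≠ 0`, and hence so does that of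
  -- every `l ∘ Φ`.
  obtain ⟨ξ, hξ, hξ0⟩ := (Submodule.ne_bot_iff _).1
    (LinearMap.ker_ne_bot_of_finrank_lt (f := (fderiv ℝ g 0).toLinearMap) hlt)
  have hgξ : fderiv ℝ g 0 ξ = 0 := hξ
  have key : ∀ l : E →L[ℝ] ℝ, l ((Λ ξ).1 • v + T (Λ ξ).2) = 0 := by
    intro l
    have hd : HasFDerivAt (fun z => l (Φ z)) ((fderiv ℝ (fun y => l (Q y)) (g 0)).comp
        (fderiv ℝ g 0)) 0 := by
      refine ((hQ l).hasFDerivAt.comp 0 hg.hasFDerivAt).congr_of_eventuallyEq ?_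
      filter_upwards [hΦ] with z hz
      rw [hz]
      rfl
    have hline : ∀ w : W, HasDerivAt (fun s : ℝ => l (Φ (s • w)))
        (fderiv ℝ (fun y => l (Q y)) (g 0) (fderiv ℝ g 0 w)) 0 := by
      intro w
      have h1 : HasDerivAt (fun s : ℝ => s • w) w 0 := by
        simpa using (hasDerivAt_id (0 : ℝ)).smul_const w
      exact HasFDerivAt.comp_hasDerivAt (f := fun s : ℝ => s • w) (0 : ℝ) (by simpa using hd) h1
    have e1 : fderiv ℝ (fun y => l (Q y)) (g 0) (fderiv ℝ g 0 (Λ.symm (1, 0))) = l v := by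
      refine (hline _).unique ?_
      have e : (fun s : ℝ => l (Φ (Λ.symm (s, 0)))) = fun s => l (Φ (s • Λ.symm (1, 0))) := by
        funext s
        rw [← map_smul]
        simp
      exact e ▸ hv l
    have e2 : ∀ u, fderiv ℝ (fun y => l (Q y)) (g 0) (fderiv ℝ g 0 (Λ.symm (0, u))) = l (T u) := by
      intro u
      refine (hline _).unique ?_
      have e : ∀ s : ℝ, Λ.symm (0, s • u) = s • Λ.symm (0, u) := fun s => by
        rw [← map_smul]
        simp
      simpa only [e] using hu l u
    have e3 : ξ = (Λ ξ).1 • Λ.symm (1, 0) + Λ.symm (0, (Λ ξ).2) := by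
      apply Λ.injective
      simp
    rw [map_add, map_smul, ← e1, ← e2, ← map_smul, ← map_smul, ← map_add, ← map_add, ← e3, hgξ,
      map_zero]
  have h0 : (Λ ξ).1 • v + T (Λ ξ).2 = 0 := by
    by_contra h
    obtain ⟨l, hl⟩ := SeparatingDual.exists_ne_zero (R := ℝ) h
    exact hl (key l)
  -- Transversality removes the `V`-component of `ξ`; the remaining component is nonzero and
  -- multiplies `v`.
  have h1 : (Λ ξ).2 = 0 := hT _ (-(Λ ξ).1) (by rw [neg_smul]; exact eq_neg_of_add_eq_zero_right h0)
  rw [h1, map_zero, add_zero] at h0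
  refine (smul_eq_zero.1 h0).resolve_left fun h2 => hξ0 ?_
  exact Λ.map_eq_zero_iff.1 (Prod.ext h2 h1)

variable {A : SmoothAtlas E M} {d n : ℕ}

/-- Moving a `d`-dimensional plot through `x` by the family sweeps out `d + 1` dimensions if `v` is
transverse to its image, which the skeletal diffeology forbids unless `v = 0`. -/
theorem eq_zero_of_tendsto_slope_orbit
    {p : EuclideanSpace ℝ (Fin n) → aut (skeletal d (manifoldDiffeology A))}
    (hp : @DSmooth (EuclideanSpace ℝ (Fin n) × M) M
      (prodDiffeology inferInstance (skeletal d (manifoldDiffeology A)))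
      (skeletal d (manifoldDiffeology A)) fun z => (p z.1).1 z.2)
    {r : ℝ → EuclideanSpace ℝ (Fin n)} (hr : ContDiff ℝ ∞ r) {x : M} {i : ι} {t : ℝ}
    (hi : (p (r t)).1 x ∈ (A.chart i).source) (hd : (d : Cardinal) < Module.rank ℝ (E i)) {v : E i}
    (hv : Tendsto (slope (fun s => A.chart i ((p (r s)).1 x)) t) (𝓝[≠] t) (𝓝 v)) : v = 0 := by
  obtain ⟨T, hT⟩ := exists_linearMap_transverse hd v
  let y₀ := A.chart i ((p (r t)).1 x)
  have hy₀ : y₀ ∈ (A.chart i).target := (A.chart i).map_source hi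
  have hTs : ∀ c : ℝ → EuclideanSpace ℝ (Fin d), ContDiff ℝ ∞ c →
      IsSmoothCurve fun s => y₀ + T (c s) := fun c hc => isSmoothCurve_const_add_linearMap y₀ T hc
  have hU : IsOpen {u | y₀ + T u ∈ (A.chart i).target} := IsCInftyOpen.isOpen fun c hc =>
    A.isCInftyOpen_target i _ (hTs c (isSmoothCurve_iff_contDiff.1 hc))
  obtain ⟨ρ, hρ, hρ0, hρU⟩ := exists_contDiff_localizer
    (hU.mem_nhds (x := 0) (by simpa using hy₀))
  have hρ00 : ρ 0 = 0 := hρ0.eq_of_nhds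
  -- Pulling back by `p (r t)` makes the image of `w` under `p (r t)` the affine plane `y₀ + T u` in
  -- the chart for small `u`.
  let w : EuclideanSpace ℝ (Fin d) → M := (p (r t)).1.symm ∘ (A.chart i).symm ∘ fun u => y₀ + T (ρ u)
  have hw : @IsPlot _ (skeletal d (manifoldDiffeology A)) d w :=
    (p (r t)).2.2 _ _ (isPlot_skeletal (isPlot_chart_symm_comp A
      (fun c hc => hTs (ρ ∘ c) (hρ.comp hc)) hρU) le_rfl)
  have hw0 : w 0 = x := by
    simp [w, hρ00, y₀, (A.chart i).left_inv hi]
  let Λ : EuclideanSpace ℝ (Fin (d + 1)) ≃L[ℝ] ℝ × EuclideanSpace ℝ (Fin d) :=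
    ContinuousLinearEquiv.ofFinrankEq (by simp [add_comm])
  let G : EuclideanSpace ℝ (Fin (d + 1)) → M := fun z => (p (r (t + (Λ z).1))).1 (w (Λ z).2)
  have hG : @IsPlot _ (skeletal d (manifoldDiffeology A)) (d + 1) G := by
    refine hp (d + 1) (fun z => (r (t + (Λ z).1), w (Λ z).2))
      (DiffeologicalSpace.isPlot_inf_iff.2 ⟨?_, ?_⟩)
    · have : ContDiff ℝ ∞ fun z => r (t + (Λ z).1) :=
        hr.comp (contDiff_const.add (contDiff_fst.comp Λ.contDiff))
      exact this.isPlot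
    · exact (skeletal d (manifoldDiffeology A)).plot_reparam (f := fun z => (Λ z).2) hw
        (contDiff_snd.comp Λ.contDiff)
  obtain ⟨k, hk, P, hP, g, hg, hGP⟩ := exists_factor_of_isPlot_skeletal hG 0
  have hPg : P (g 0) ∈ (A.chart i).source := by
    have h1 : G 0 = P (g 0) := hGP.eq_of_nhds
    rw [← h1]
    simpa [G, hw0] using hi
  refine not_factor_of_transverse (V := EuclideanSpace ℝ (Fin d)) (by simpa using hk) Λ
    (Φ := fun z => A.chart i (G z)) (Q := fun y => A.chart i (P y))
    (hg.differentiable (by simp) 0) ?_ (differentiableAt_chart_comp hP hPg) hT (fun l => ?_)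
    fun l u => ?_
  · filter_upwards [hGP] with z hz
    rw [hz]
    rfl
  · have h1 : HasDerivAt (fun s => l (A.chart i ((p (r s)).1 x))) (l v) (t + 0) := by
      rw [add_zero, hasDerivAt_iff_tendsto_slope]
      have e : slope (fun s => l (A.chart i ((p (r s)).1 x))) t =
          l ∘ slope (fun s => A.chart i ((p (r s)).1 x)) t := by
        funext s
        simp [slope_def_module]
      rw [e]
      exact (l.continuous.tendsto v).comp hv
    simpa [G, hw0] using h1.comp_const_add t 0
  · have h1 : HasDerivAt (fun s : ℝ => l y₀ + s * l (T u)) (l (T u)) 0 := by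
      simpa using ((hasDerivAt_id (0 : ℝ)).mul_const (l (T u))).const_add (l y₀)
    refine h1.congr_of_eventuallyEq ?_
    have h2 : Tendsto (fun s : ℝ => s • u) (𝓝 0) (𝓝 0) :=
      Continuous.tendsto' (by fun_prop) _ _ (zero_smul _ _)
    filter_upwards [h2.eventually hρ0] with s hs
    have h3 : G (Λ.symm (0, s • u)) = (A.chart i).symm (y₀ + T (ρ (s • u))) := by
      simp [G, w]
    rw [h3, (A.chart i).right_inv (hρU _), hs]
    simp

theorem eq_of_forall_slope_tendsto_zero {F : Type*} [AddCommGroup F] [Module ℝ F]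
    [TopologicalSpace F] [SeparatingDual ℝ F] {c : ℝ → F}
    (hc : ∀ t, Tendsto (slope c t) (𝓝[≠] t) (𝓝 0)) (s t : ℝ) : c s = c t := by
  by_contra h
  obtain ⟨l, hl⟩ := SeparatingDual.exists_ne_zero (R := ℝ) (sub_ne_zero.2 h)
  refine hl ?_
  rw [map_sub, sub_eq_zero]
  have hd : ∀ a, HasDerivAt (fun b => l (c b)) 0 a := fun a => by
    rw [hasDerivAt_iff_tendsto_slope]
    have e : slope (fun b => l (c b)) a = l ∘ slope c a := by
      funext b
      simp [slope_def_module]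
    rw [e, ← map_zero l]
    exact (l.continuous.tendsto 0).comp (hc a)
  exact is_const_of_deriv_eq_zero (fun a => (hd a).differentiableAt) (fun a => (hd a).deriv) s t

/-- A smooth family of diffeomorphisms of the skeletal diffeology is constant. -/
theorem eq_of_dSmooth_uncurry
    (hdim : ∀ i, (A.chart i).source.Nonempty → (d : Cardinal) < Module.rank ℝ (E i))
    {p : EuclideanSpace ℝ (Fin n) → aut (skeletal d (manifoldDiffeology A))}
    (hp : @DSmooth (EuclideanSpace ℝ (Fin n) × M) M
      (prodDiffeology inferInstance (skeletal d (manifoldDiffeology A)))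
      (skeletal d (manifoldDiffeology A)) fun z => (p z.1).1 z.2)
    (a b : EuclideanSpace ℝ (Fin n)) : p a = p b := by
  refine Subtype.ext (Equiv.ext fun x => ?_)
  let r : ℝ → EuclideanSpace ℝ (Fin n) := fun t => a + t • (b - a)
  have hr : ContDiff ℝ ∞ r := by fun_prop
  have hplot : @IsPlot _ (manifoldDiffeology A) n fun z => (p z).1 x := by
    refine isPlot_of_skeletal (hp n (fun z => (z, x)) (DiffeologicalSpace.isPlot_inf_iff.2 ⟨?_, ?_⟩))
    · exact isPlot_id
    · exact (skeletal d (manifoldDiffeology A)).constant_plots x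
  have hloc : IsLocallyConstant fun t => (p (r t)).1 x := by
    rw [IsLocallyConstant.iff_eventually_eq]
    intro t
    obtain ⟨i, hi⟩ := A.cover ((p (r t)).1 x)
    have h1 := isPlot_manifoldDiffeology_iff.1 hplot i
    obtain ⟨φ, hφ, hφt, hφN⟩ := exists_localizer
      ((h1.1 r (isSmoothCurve_iff_contDiff.2 hr)).mem_nhds hi)
    obtain ⟨D, hD0, hD⟩ := h1.2 (r ∘ φ) (isSmoothCurve_iff_contDiff.2 (hr.comp hφ)) hφN
    have hconst : ∀ s, D 0 s = D 0 t := fun s => by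
      refine eq_of_forall_slope_tendsto_zero (fun s => ?_) s t
      have h2 := hD 0 s
      have h3 := eq_zero_of_tendsto_slope_orbit hp (hr.comp hφ) (x := x) (i := i) (t := s)
        (hφN s) (hdim i ⟨_, hi⟩) (v := D 1 s) (by rw [hD0] at h2; exact h2)
      rw [← h3]
      exact h2
    rw [hD0] at hconst
    filter_upwards [hφt] with s hs
    -- Injectivity of the chart carries constancy over to `M`, so no separation axiom is needed.
    have h2 := (A.chart i).injOn (hφN s) (hφN t) (hconst s)
    have h3 : φ t = t := hφt.eq_of_nhds
    simpa [hs, h3] using h2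
  have := hloc.apply_eq_of_preconnectedSpace 0 1
  simpa [r] using this

/-- Here plots are defined on entire Euclidean spaces, so a plot is even constant; conversely,
locally constant maps are plots by the locality axiom. -/
theorem autDiffeology_skeletal_eq_discrete
    (hdim : ∀ i, (A.chart i).source.Nonempty → (d : Cardinal) < Module.rank ℝ (E i)) :
    autDiffeology (skeletal d (manifoldDiffeology A)) =
      discrete (aut (skeletal d (manifoldDiffeology A))) := by
  refine DiffeologicalSpace.ext ?_
  funext n p
  refine propext ⟨fun hp => ?_, fun hp => ?_⟩
  · have h1 := (DiffeologicalSpace.isPlot_inf_iff.1 hp).1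
    exact fun x _ => Eventually.of_forall fun y => eq_of_dSmooth_uncurry hdim h1 y x
  · refine (autDiffeology (skeletal d (manifoldDiffeology A))).locality fun x => ?_
    obtain ⟨u, hu, huo, hxu⟩ := eventually_nhds_iff.1 (hp x (mem_univ x))
    refine ⟨u, huo, hxu, fun {m f} hf _ => ?_⟩
    have : p ∘ f = fun _ => p x := funext fun z => hu _ (hf z)
    rw [this]
    exact (autDiffeology (skeletal d (manifoldDiffeology A))).constant_plots _

end Discreteness

end SkeletalDiffeology

open SkeletalDiffeology in
theorem corollary1p3 {ι : Type*} {E : ι → Type*} [∀ i, AddCommGroup (E i)] [∀ i, Module ℝ (E i)]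
    [∀ i, TopologicalSpace (E i)] [∀ i, ConvenientSpace (E i)] {M : Type*} (A : SmoothAtlas E M)
    (d : ℕ) (hd : 0 < d)
    (hdim : ∀ i, (A.chart i).source.Nonempty → (d : Cardinal) < Module.rank ℝ (E i)) :
    (∀ f : Equiv.Perm M, f ∈ aut (skeletal d (manifoldDiffeology A)) ↔ IsManifoldDiffeo A f) ∧
      autDiffeology (skeletal d (manifoldDiffeology A)) =
        discrete (aut (skeletal d (manifoldDiffeology A))) :=
  ⟨mem_aut_skeletal_iff A hd, autDiffeology_skeletal_eq_discrete hdim⟩
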